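/- Let $d\ge 0$ be an integer, let $Q=[a_1,b_1]\times\dots\times[a_d,b_d]\subset\mathbb{R}^d$ with $a_i<b_i$ for all $i$, let $\lambda$ be Lebesgue measure, and let $\sigma\in\{-1,0,1\}^d$. Write $x\le_\sigma y$ iff $\sigma_i x_i\le\sigma_i y_i$ for every $i$ with $\sigma_i\neq 0$ and $x_i=y_i$ for every $i$ with $\sigma_i=0$. A set $L\subset Q$ is $\sigma$-lower iff $x,y\in Q$, $x\le_\sigma y$, $y\in L$ imply $x\in L$; a set $U\subset Q$ is $\sigma$-upper iff $x,y\in Q$, $x\le_\sigma y$, $x\in U$ imply $y\in U$. Let $L^2_\sigma(Q,\mathbb{R})$ be the set of all $g\in L^2(Q,\mathbb{R})$ for which there is a $\lambda$-null set $N$ such that $g(x)\le g(y)$ for all $x,y\in Q\setminus N$ with $x\le_\sigma y$. For $n\in\mathbb{N}$ divide each $[a_i,b_i]$ into $2^n$ intervals of equal length, half-open of the form $[s,t)$ except for the last one, which is closed; the products of these intervals are the dyadic cells of level $n$. For $c>0$ let $S(Q,[c,\infty))$ be the set of functions $Q\to[c,\infty)$ that, for some $n$, are constant on each dyadic cell of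 level $n$, and let $S^\infty(Q,(0,\infty))$ be the union over $c>0$ of the closures of $S(Q,[c,\infty))$ with respect to the essential supremum norm. Let $f\in L^2(Q,\mathbb{R})$ and $w\in S^\infty(Q,(0,\infty))$, and let $f^*=p_\sigma^w(f)$ be the $\sigma$-monotonic regression of $f$, that is, the unique minimizer of $g\mapsto\int_Q|f-g|^2\,w\,d\lambda$ over $g\in L^2_\sigma(Q,\mathbb{R})$. For measurable $E\subset Q$ with $\lambda(E)>0$ put $$\operatorname{Av}_{f,w}(E)=\frac{\int_E f w\,d\lambda}{\int_E w\,d\lambda}.$$ Then the following hold. 1. For every $c\in\mathbb{R}$ and every Lebesgue measurable $\sigma$-lower set $L\subset Q$ with $\lambda(L\cap\{f^*\ge c\})>0$, one has $\operatorname{Av}_{f,w}(L\cap\{f^*\ge c\})\ge c$. 2. For every $c\in\mathbb{R}$ and every Lebesgue measurable $\sigma$-upper set $U\subset Q$ with $\lambda(\{f^*\le c\}\cap U)>0$, one has $\operatorname{Av}_{f,w}(\{f^*\le c\}\cap U)\le c$. 3. For every $c\in\mathbb{R}$ with $\lambda(\{f^*=c\})>0$, one has $\operatorname{Av}_{f,w}(\{f^*=c\})=c$.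 4. If $I\subset\mathbb{R}$ is any interval with $f(x)\in I$ for a.e. $x\in Q$, then $f^*(x)\in I$ for a.e. $x\in Q$. -/

import Mathlib

open MeasureTheory

namespace MonReg

/-- The partial order `x ≤_σ y` on `ℝ^d` for a signature `σ ∈ {-1,0,1}^d`. -/
def SigmaLE {d : ℕ} (σ : Fin d → SignType) (x y : Fin d → ℝ) : Prop :=
  ∀ i, (σ i ≠ 0 → ((σ i : SignType) : ℝ) * x i ≤ ((σ i : SignType) : ℝ) * y i) ∧
    (σ i = 0 → x i = y i)

/-- `L` is a lower set on `X` with respect to `≤_σ`. -/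
def IsSigmaLower {d : ℕ} (σ : Fin d → SignType) (X L : Set (Fin d → ℝ)) : Prop :=
  L ⊆ X ∧ ∀ x ∈ X, ∀ y ∈ X, SigmaLE σ x y → y ∈ L → x ∈ L

/-- `U` is an upper set on `X` with respect to `≤_σ`. -/
def IsSigmaUpper {d : ℕ} (σ : Fin d → SignType) (X U : Set (Fin d → ℝ)) : Prop :=
  U ⊆ X ∧ ∀ x ∈ X, ∀ y ∈ X, SigmaLE σ x y → x ∈ U → y ∈ U

/-- `g` is essentially `σ`-monotonic on `X`: off some Lebesgue null set `N`, the restriction of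
`g` is isotonic with respect to `≤_σ`. -/
def EssSigmaMonotone {d : ℕ} (σ : Fin d → SignType) (X : Set (Fin d → ℝ))
    (g : (Fin d → ℝ) → ℝ) : Prop :=
  ∃ N : Set (Fin d → ℝ), volume N = 0 ∧
    ∀ x ∈ X \ N, ∀ y ∈ X \ N, SigmaLE σ x y → g x ≤ g y

/-- (Representatives of) elements of `L²_σ(X, ℝ)`. -/
def MemL2Sigma {d : ℕ} (σ : Fin d → SignType) (X : Set (Fin d → ℝ))
    (g : (Fin d → ℝ) → ℝ) : Prop :=
  MemLp g 2 (volume.restrict X) ∧ EssSigmaMonotone σ X g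

/-- The weighted squared distance `J_{f,w}(g) = ∫_X |f - g|² w dλ`. -/
noncomputable def sqDist {d : ℕ} (X : Set (Fin d → ℝ)) (w f g : (Fin d → ℝ) → ℝ) : ℝ :=
  ∫ x in X, |f x - g x| ^ 2 * w x

/-- `p` is (a representative of) a closest point of `L²_σ(X, ℝ)` to `f` in the `w`-weighted
`2`-norm. -/
def IsSigmaProjection {d : ℕ} (σ : Fin d → SignType) (X : Set (Fin d → ℝ))
    (w f p : (Fin d → ℝ) → ℝ) : Prop :=
  MemL2Sigma σ X p ∧ ∀ g, MemL2Sigma σ X g → sqDist X w f p ≤ sqDist X w f g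

/-- The `σ`-monotonic regression `p_σ^w(f)`: a representative of the closest point of
`L²_σ(X, ℝ)` to `f`. -/
noncomputable def monRegression {d : ℕ} (σ : Fin d → SignType) (X : Set (Fin d → ℝ))
    (w f : (Fin d → ℝ) → ℝ) : (Fin d → ℝ) → ℝ :=
  Classical.epsilon (IsSigmaProjection σ X w f)

/-- The weighted average `Av_{f,w}(E)`. -/
noncomputable def Av {d : ℕ} (f w : (Fin d → ℝ) → ℝ) (E : Set (Fin d → ℝ)) : ℝ :=
  (∫ x in E, f x * w x) / ∫ x in E, w x

/-- The `k`-th partition point of the dyadic partition of `[s, t]` into `2^n` intervals. -/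
noncomputable def dyadicPoint (s t : ℝ) (n k : ℕ) : ℝ :=
  s + k * ((t - s) / 2 ^ n)

/-- The partition intervals of the dyadic partition of `[s, t]`, indexed by `0, …, 2^n - 1`:
all are half-open except the last, which is closed. -/
noncomputable def dyadicInterval (s t : ℝ) (n : ℕ) (k : Fin (2 ^ n)) : Set ℝ :=
  if (k : ℕ) + 1 = 2 ^ n then Set.Icc (dyadicPoint s t n k) (dyadicPoint s t n (k + 1))
  else Set.Ico (dyadicPoint s t n k) (dyadicPoint s t n (k + 1))

/-- The cells of the dyadic grid of level `n` on the cuboid `∏ [a i, b i]`. -/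
noncomputable def dyadicCell {d : ℕ} (a b : Fin d → ℝ) (n : ℕ) (k : Fin d → Fin (2 ^ n)) :
    Set (Fin d → ℝ) :=
  {x | ∀ i, x i ∈ dyadicInterval (a i) (b i) n (k i)}

/-- `S(Q, I)`: the functions on `Q = ∏ [a i, b i]` with values in `I` that are constant on the
cells of some dyadic grid. -/
def MemS {d : ℕ} (a b : Fin d → ℝ) (I : Set ℝ) (g : (Fin d → ℝ) → ℝ) : Prop :=
  (∀ x ∈ Set.Icc a b, g x ∈ I) ∧
    ∃ n : ℕ, ∀ k : Fin d → Fin (2 ^ n), ∀ x ∈ dyadicCell a b n k, ∀ y ∈ dyadicCell a b n k,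
      g x = g y

/-- `S^∞(Q, (0,∞))`: the union over `c > 0` of the closures of `S(Q, [c,∞))` in `L^∞(Q)`. -/
def MemSInftyPos {d : ℕ} (a b : Fin d → ℝ) (w : (Fin d → ℝ) → ℝ) : Prop :=
  MemLp w ⊤ (volume.restrict (Set.Icc a b)) ∧
    ∃ c : ℝ, 0 < c ∧ ∀ ε : ℝ, 0 < ε → ∃ g : (Fin d → ℝ) → ℝ, MemS a b (Set.Ici c) g ∧
      eLpNorm (fun x => w x - g x) ⊤ (volume.restrict (Set.Icc a b)) ≤ ENNReal.ofReal ε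

end MonReg

open MeasureTheory Filter Topology

namespace MonReg

variable {d : ℕ} {σ : Fin d → SignType} {X : Set (Fin d → ℝ)} {w f g p : (Fin d → ℝ) → ℝ}

/-! The regression `p` minimizes a quadratic functional over a convex set, so the residual `f - p`
has weighted inner product `≤ 0` with every feasible direction. Ideally one would test with `-1` on
`L ∩ {p ≥ c}`, but lowering `p` by a constant there can break monotonicity against values just below
`c`. The jump is therefore replaced by a steep ramp in `p - c`: scaled by the inverse of its slope
it is `1`-Lipschitz in `p`, so subtracting it on a lower set keeps `p` monotonic. As the slope tends
to infinity, dominated convergence recovers the indicator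
(`IsSigmaProjection.mul_setIntegral_nonpos`).

This gives `∫ (f - p) w ≥ 0` over `L ∩ {p ≥ c}` and, dually, `≤ 0` over `{p ≤ c} ∩ U`. On a level
set a tent function in `p` is feasible with either sign, so the integral vanishes. Replacing `p` by
`c` yields the three statements on averages. For the range statement, the whole domain is both a
lower and an upper set: if `f < c` a.e., a strictly negative integrand has nonnegative integral over
`{p ≥ c}`, which must then be null.

Of the weight, only essential boundedness and a positive essential lower bound matter. They also
give existence of the minimizer (`exists_isSigmaProjection`), without which the choice defining
`monRegression` would carry no information. -/

/-! ### Bounds on the weight and stability of essential monotonicity -/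

theorem MemSInftyPos.exists_ae_ge {a b : Fin d → ℝ} (hw : MemSInftyPos a b w) :
    ∃ m : ℝ, 0 < m ∧ ∀ᵐ x ∂volume.restrict (Set.Icc a b), m ≤ w x := by
  obtain ⟨-, c, hc, h⟩ := hw
  obtain ⟨g, ⟨hg, -⟩, hgw⟩ := h (c / 2) (by positivity)
  refine ⟨c / 2, by positivity, ?_⟩
  rw [eLpNorm_exponent_top] at hgw
  filter_upwards [ae_le_eLpNormEssSup (f := fun x => w x - g x)
    (μ := volume.restrict (Set.Icc a b)), ae_restrict_mem measurableSet_Icc] with x hx hxQ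
  have h1 := hx.trans hgw
  rw [← ofReal_norm, ENNReal.ofReal_le_ofReal_iff (by positivity), Real.norm_eq_abs] at h1
  have h2 : c ≤ g x := hg x hxQ
  linarith [(abs_le.1 h1).1]

theorem EssSigmaMonotone.congr_ae (hX : MeasurableSet X) (hg : EssSigmaMonotone σ X g)
    (h : p =ᵐ[volume.restrict X] g) : EssSigmaMonotone σ X p := by
  obtain ⟨N, hN, hmono⟩ := hg
  rw [EventuallyEq, ae_restrict_iff' hX] at h
  refine ⟨N ∪ {x | ¬ (x ∈ X → p x = g x)}, measure_union_null hN h, ?_⟩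
  rintro x ⟨hx, hxN⟩ y ⟨hy, hyN⟩ hxy
  simp only [Set.mem_union, Set.mem_ofPred_eq, not_or, not_not] at hxN hyN
  rw [hxN.2 hx, hyN.2 hy]
  exact hmono x ⟨hx, hxN.1⟩ y ⟨hy, hyN.1⟩ hxy

theorem MemL2Sigma.congr_ae (hX : MeasurableSet X) (hg : MemL2Sigma σ X g)
    (h : p =ᵐ[volume.restrict X] g) : MemL2Sigma σ X p :=
  ⟨hg.1.ae_eq h.symm, hg.2.congr_ae hX h⟩

theorem IsSigmaProjection.congr_ae (hX : MeasurableSet X) (hg : IsSigmaProjection σ X w f g)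
    (h : p =ᵐ[volume.restrict X] g) : IsSigmaProjection σ X w f p := by
  refine ⟨hg.1.congr_ae hX h, fun q hq => ?_⟩
  have : sqDist X w f p = sqDist X w f g := by
    refine integral_congr_ae ?_
    filter_upwards [h] with x hx
    rw [hx]
  exact this ▸ hg.2 q hq

theorem MemL2Sigma.convex_comb {g₁ g₂ : (Fin d → ℝ) → ℝ} (h₁ : MemL2Sigma σ X g₁)
    (h₂ : MemL2Sigma σ X g₂) {s t : ℝ} (hs : 0 ≤ s) (ht : 0 ≤ t) :
    MemL2Sigma σ X (fun x => s * g₁ x + t * g₂ x) := by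
  refine ⟨(h₁.1.const_mul s).add (h₂.1.const_mul t), ?_⟩
  obtain ⟨N₁, hN₁, m₁⟩ := h₁.2
  obtain ⟨N₂, hN₂, m₂⟩ := h₂.2
  refine ⟨N₁ ∪ N₂, measure_union_null hN₁ hN₂, ?_⟩
  rintro x ⟨hx, hxN⟩ y ⟨hy, hyN⟩ hxy
  simp only [Set.mem_union, not_or] at hxN hyN
  have e₁ := m₁ x ⟨hx, hxN.1⟩ y ⟨hy, hyN.1⟩ hxy
  have e₂ := m₂ x ⟨hx, hxN.2⟩ y ⟨hy, hyN.2⟩ hxy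
  have := mul_le_mul_of_nonneg_left e₁ hs
  have := mul_le_mul_of_nonneg_left e₂ ht
  dsimp only
  linarith

/-- Essential monotonicity passes to almost everywhere limits of sequences. -/
theorem EssSigmaMonotone.of_tendsto_ae (hX : MeasurableSet X) {G : ℕ → (Fin d → ℝ) → ℝ}
    (hG : ∀ n, EssSigmaMonotone σ X (G n))
    (h : ∀ᵐ x ∂volume.restrict X, Tendsto (fun n => G n x) atTop (𝓝 (g x))) :
    EssSigmaMonotone σ X g := by
  choose N hN hmono using hG
  rw [ae_restrict_iff' hX] at h
  refine ⟨(⋃ n, N n) ∪ {x | ¬ (x ∈ X → Tendsto (fun n => G n x) atTop (𝓝 (g x)))},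
    measure_union_null (measure_iUnion_null hN) h, ?_⟩
  rintro x ⟨hx, hxN⟩ y ⟨hy, hyN⟩ hxy
  simp only [Set.mem_union, Set.mem_ofPred_eq, not_or, not_not, Set.mem_iUnion, not_exists]
    at hxN hyN
  exact le_of_tendsto_of_tendsto' (hxN.2 hx) (hyN.2 hy) fun n =>
    hmono n x ⟨hx, hxN.1 n⟩ y ⟨hy, hyN.1 n⟩ hxy

/-! ### Existence of the weighted projection -/

theorem memLp_two_mul_of_top {μ : Measure (Fin d → ℝ)} (hg : MemLp g 2 μ) (hw : MemLp w ⊤ μ) :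
    MemLp (fun x => w x * g x) 2 μ :=
  hg.mul hw

theorem memLp_sqrt_top {μ : Measure (Fin d → ℝ)} (hw : MemLp w ⊤ μ) :
    MemLp (fun x => √(w x)) ⊤ μ := by
  have hb := ae_le_eLpNormEssSup (f := w) (μ := μ)
  rw [← eLpNorm_exponent_top] at hb
  refine memLp_top_of_bound
    (Real.continuous_sqrt.comp_aestronglyMeasurable hw.1) (√(eLpNorm w ⊤ μ).toReal) ?_
  filter_upwards [hb] with x hx
  rw [Real.norm_of_nonneg (Real.sqrt_nonneg _)]
  refine Real.sqrt_le_sqrt ((le_abs_self _).trans ?_)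
  rw [← Real.norm_eq_abs, ← toReal_enorm]
  exact ENNReal.toReal_mono hw.2.ne hx

theorem memLp_inv_sqrt_top {μ : Measure (Fin d → ℝ)} (hw : AEStronglyMeasurable w μ) {m : ℝ}
    (hm : 0 < m) (hmw : ∀ᵐ x ∂μ, m ≤ w x) : MemLp (fun x => (√(w x))⁻¹) ⊤ μ := by
  refine memLp_top_of_bound
    (Real.continuous_sqrt.comp_aestronglyMeasurable hw).aemeasurable.inv.aestronglyMeasurable
    (√m)⁻¹ ?_
  filter_upwards [hmw] with x hx
  rw [Real.norm_of_nonneg (by positivity)]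
  exact inv_anti₀ (Real.sqrt_pos.2 hm) (Real.sqrt_le_sqrt hx)

/-- The weighted `L²` distance attains its minimum on the closed convex set
of essentially `σ`-monotonic functions. -/
theorem exists_isSigmaProjection (hX : MeasurableSet X) (hw : MemLp w ⊤ (volume.restrict X))
    {m : ℝ} (hm : 0 < m) (hmw : ∀ᵐ x ∂volume.restrict X, m ≤ w x)
    (hf : MemLp f 2 (volume.restrict X)) : ∃ p, IsSigmaProjection σ X w f p := by
  set μ := volume.restrict X with hμ
  have hr := memLp_sqrt_top hw
  have hri := memLp_inv_sqrt_top hw.1 hm hmw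
  have hpos : ∀ᵐ x ∂μ, 0 < √(w x) := by
    filter_upwards [hmw] with x hx using Real.sqrt_pos.2 (hm.trans_le hx)
  -- Multiplication by `√w` turns the weighted distance into the ordinary `L²` distance; `K` is the
  -- image of the monotonic functions under it.
  let K : Set (Lp ℝ 2 μ) := {h | MemL2Sigma σ X fun x => (√(w x))⁻¹ * h x}
  have hemb : ∀ g, (hg : MemL2Sigma σ X g) → (memLp_two_mul_of_top hg.1 hr).toLp _ ∈ K := by
    intro g hg
    refine hg.congr_ae hX ?_
    filter_upwards [(memLp_two_mul_of_top hg.1 hr).coeFn_toLp, hpos] with x hx hx0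
    rw [hx, inv_mul_cancel_left₀ hx0.ne']
  have hne : K.Nonempty :=
    ⟨_, hemb (fun _ => 0) ⟨MemLp.zero', ∅, measure_empty, fun _ _ _ _ _ => le_rfl⟩⟩
  have hconv : Convex ℝ K := by
    intro h₁ hh₁ h₂ hh₂ s t hs ht _
    refine (MemL2Sigma.convex_comb hh₁ hh₂ hs ht).congr_ae hX ?_
    filter_upwards [Lp.coeFn_add (s • h₁) (t • h₂), Lp.coeFn_smul s h₁, Lp.coeFn_smul t h₂]
      with x e₁ e₂ e₃
    rw [e₁, Pi.add_apply, e₂, e₃]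
    simp only [Pi.smul_apply, smul_eq_mul]
    ring
  have hclosed : IsClosed K := by
    refine IsSeqClosed.isClosed fun u h hu hlim => ?_
    refine ⟨memLp_two_mul_of_top (Lp.memLp h) hri, ?_⟩
    -- `L²` convergence gives convergence in measure, hence a.e. along a subsequence, and
    -- monotonicity survives a.e. limits.
    obtain ⟨φ, -, hφ⟩ := (tendstoInMeasure_of_tendsto_Lp hlim).exists_seq_tendsto_ae
    refine EssSigmaMonotone.of_tendsto_ae hX (fun n => (hu (φ n)).2) ?_
    filter_upwards [hφ] with x hx using hx.const_mul _
  set F := (memLp_two_mul_of_top hf hr).toLp _ with hF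
  obtain ⟨v, hvK, hv⟩ := exists_norm_eq_iInf_of_complete_convex hne hclosed.isComplete hconv F
  have hdist : ∀ h : Lp ℝ 2 μ,
      sqDist X w f (fun x => (√(w x))⁻¹ * h x) = ‖F - h‖ ^ 2 := by
    intro h
    rw [← real_inner_self_eq_norm_sq, L2.inner_def]
    refine integral_congr_ae ?_
    filter_upwards [Lp.coeFn_sub F h, (memLp_two_mul_of_top hf hr).coeFn_toLp, hpos, hmw]
      with x e₁ e₂ e₃ e₄
    rw [e₁, Pi.sub_apply, e₂]
    simp only [real_inner_self_eq_norm_sq, Real.norm_eq_abs, sq_abs]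
    have e₅ : w x = √(w x) ^ 2 := (Real.sq_sqrt (hm.le.trans e₄)).symm
    have e₆ : √(w x) * f x - h x = √(w x) * (f x - (√(w x))⁻¹ * h x) := by
      field_simp
    rw [e₆, mul_pow, ← e₅, mul_comm]
  refine ⟨_, hvK, fun g hg => ?_⟩
  have hgd : sqDist X w f g =
      sqDist X w f (fun x => (√(w x))⁻¹ * (memLp_two_mul_of_top hg.1 hr).toLp _ x) := by
    refine integral_congr_ae ?_
    filter_upwards [(memLp_two_mul_of_top hg.1 hr).coeFn_toLp, hpos] with x hx hx0
    rw [hx, inv_mul_cancel_left₀ hx0.ne']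
  rw [hgd, hdist, hdist, hv]
  refine pow_le_pow_left₀ (Real.iInf_nonneg fun _ => norm_nonneg _) ?_ 2
  exact ciInf_le ⟨0, by rintro _ ⟨_, rfl⟩; exact norm_nonneg _⟩ (⟨_, hemb g hg⟩ : K)

/-! ### Variational inequality -/

/-- The residual of the projection has nonpositive inner product with every bounded
feasible direction. -/
theorem IsSigmaProjection.integral_mul_nonpos [IsFiniteMeasure (volume.restrict X)]
    (hp : IsSigmaProjection σ X w f p) (hw : MemLp w ⊤ (volume.restrict X))
    (hf : MemLp f 2 (volume.restrict X)) {h : (Fin d → ℝ) → ℝ} {ε : ℝ} (hε : 0 < ε)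
    (hh : MemLp h 2 (volume.restrict X)) (hph : EssSigmaMonotone σ X fun x => p x + ε * h x) :
    ∫ x in X, (f x - p x) * h x * w x ≤ 0 := by
  set μ := volume.restrict X with hμ
  have hfp : MemLp (fun x => f x - p x) 2 μ := hf.sub hp.1.1
  have i₁ : Integrable (fun x => (f x - p x) * h x * w x) μ := by
    refine (hfp.integrable_mul (memLp_two_mul_of_top hh hw)).congr (ae_of_all _ fun x => ?_)
    simp only [Pi.mul_apply]; ring
  have i₂ : Integrable (fun x => h x ^ 2 * w x) μ := by
    refine (hh.integrable_mul (memLp_two_mul_of_top hh hw)).congr (ae_of_all _ fun x => ?_)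
    simp only [Pi.mul_apply]; ring
  have i₀ : Integrable (fun x => |f x - p x| ^ 2 * w x) μ := by
    refine (hfp.integrable_mul (memLp_two_mul_of_top hfp hw)).congr (ae_of_all _ fun x => ?_)
    simp only [Pi.mul_apply, sq_abs]; ring
  set A := ∫ x, (f x - p x) * h x * w x ∂μ with hA
  set B := ∫ x, h x ^ 2 * w x ∂μ with hB
  -- Compare `p` with `p + tεh`, which is feasible as a convex combination of `p` and `p + εh`;
  -- divide the expanded inequality by `tε`, then let `t → 0`.
  have key : ∀ t : ℝ, 0 < t → t ≤ 1 → 2 * A ≤ t * ε * B := by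
    intro t ht ht1
    have hmem : MemL2Sigma σ X fun x => p x + ε * h x := ⟨hp.1.1.add (hh.const_mul ε), hph⟩
    have hcomb := hp.1.convex_comb hmem (sub_nonneg.2 ht1) ht.le
    have hle := hp.2 _ hcomb
    have hexp : sqDist X w f (fun x => (1 - t) * p x + t * (p x + ε * h x)) =
        sqDist X w f p - 2 * (t * ε) * A + (t * ε) ^ 2 * B := by
      rw [sqDist, sqDist, hA, hB, ← integral_const_mul, ← integral_const_mul,
        ← integral_sub i₀ (i₁.const_mul _)]
      refine Eq.trans ?_ (integral_add (i₀.sub (i₁.const_mul _)) (i₂.const_mul _))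
      refine integral_congr_ae (ae_of_all _ fun x => ?_)
      simp only [sq_abs]
      ring
    rw [hexp] at hle
    have htε : 0 < t * ε := mul_pos ht hε
    have : (t * ε) * (2 * A) ≤ (t * ε) * (t * ε * B) := by nlinarith
    exact le_of_mul_le_mul_left this htε
  have hlim : Tendsto (fun t : ℝ => t * ε * B) (𝓝[>] 0) (𝓝 0) := by
    have : Continuous fun t : ℝ => t * ε * B := by fun_prop
    simpa using (this.tendsto 0).mono_left nhdsWithin_le_nhds
  have : 2 * A ≤ 0 := by
    refine ge_of_tendsto hlim ?_
    filter_upwards [Ioc_mem_nhdsGT one_pos] with t ht using key t ht.1 ht.2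
  linarith

/-- The direction `s • 1_E` may be approximated by bounded feasible directions. -/
theorem IsSigmaProjection.mul_setIntegral_nonpos [IsFiniteMeasure (volume.restrict X)]
    (hp : IsSigmaProjection σ X w f p) (hw : MemLp w ⊤ (volume.restrict X))
    (hf : MemLp f 2 (volume.restrict X)) {E : Set (Fin d → ℝ)} (hEX : E ⊆ X)
    (hE : NullMeasurableSet E (volume.restrict X)) (s : ℝ) {h : ℕ → (Fin d → ℝ) → ℝ}
    (hm : ∀ n, AEStronglyMeasurable (h n) (volume.restrict X)) (hb : ∀ n x, |h n x| ≤ 1)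
    (hmono : ∀ n : ℕ, EssSigmaMonotone σ X fun x => p x + ((n : ℝ) + 1)⁻¹ * h n x)
    (hlim : ∀ x ∈ X, Tendsto (fun n => h n x) atTop (𝓝 (E.indicator (fun _ => s) x)))
    (hX : MeasurableSet X) :
    s * ∫ x in E, (f x - p x) * w x ≤ 0 := by
  have hfp : MemLp (fun x => f x - p x) 2 (volume.restrict X) := hf.sub hp.1.1
  have i₀ : Integrable (fun x => (f x - p x) * w x) (volume.restrict X) :=
    (hfp.mul hw : MemLp _ 2 _).integrable one_le_two |>.congr (ae_of_all _ fun x => mul_comm _ _)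
  have hle : ∀ n, ∫ x in X, (f x - p x) * h n x * w x ≤ 0 := fun n =>
    hp.integral_mul_nonpos hw hf (ε := ((n : ℝ) + 1)⁻¹) (by positivity)
      (MemLp.of_bound (hm n) 1 (ae_of_all _ fun x => hb n x)) (hmono n)
  have hdct : Tendsto (fun n => ∫ x in X, (f x - p x) * h n x * w x) atTop
      (𝓝 (∫ x in X, (f x - p x) * E.indicator (fun _ => s) x * w x)) := by
    refine tendsto_integral_of_dominated_convergence (fun x => |(f x - p x) * w x|)
      (fun n => (hfp.1.mul (hm n)).mul hw.1) i₀.abs (fun n => ae_of_all _ fun x => ?_) ?_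
    · rw [Real.norm_eq_abs, mul_right_comm, abs_mul]
      exact mul_le_of_le_one_right (abs_nonneg _) (hb n x)
    · filter_upwards [ae_restrict_mem hX] with x hx
      exact ((hlim x hx).const_mul _).mul_const _
  have hfin := le_of_tendsto' hdct hle
  have heq : ∫ x in X, (f x - p x) * E.indicator (fun _ => s) x * w x =
      s * ∫ x in E, (f x - p x) * w x := by
    -- `E` is only known to be null measurable for the measure restricted to `X`, so the integral
    -- over `E` is first written with the doubly restricted measure.
    rw [← integral_const_mul, ← Measure.restrict_restrict_of_subset hEX, ← integral_indicator₀ hE]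
    refine integral_congr_ae (ae_of_all _ fun x => ?_)
    by_cases hx : x ∈ E <;> simp [hx]
    ring
  rwa [heq] at hfin

/-! ### The ramp function -/

/-- A piecewise linear cutoff, increasing from `0` to `1` on `[-1, 0]`. -/
noncomputable def ramp (t : ℝ) : ℝ := min 1 (max 0 (t + 1))

theorem ramp_nonneg (t : ℝ) : 0 ≤ ramp t := le_min zero_le_one (le_max_left _ _)

theorem ramp_le_one (t : ℝ) : ramp t ≤ 1 := min_le_left _ _

theorem abs_ramp_le_one (t : ℝ) : |ramp t| ≤ 1 :=
  abs_le.2 ⟨by linarith [ramp_nonneg t], ramp_le_one t⟩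

theorem continuous_ramp : Continuous ramp := by unfold ramp; fun_prop

theorem ramp_mono {s t : ℝ} (h : s ≤ t) : ramp s ≤ ramp t := by unfold ramp; gcongr

theorem ramp_le_add (s : ℝ) {r : ℝ} (h : 0 ≤ r) : ramp (s + r) ≤ ramp s + r := by
  unfold ramp
  rw [← min_add_add_right, ← max_add_add_right]
  exact min_le_min (by linarith) (max_le_max (by linarith) (by linarith))

theorem ramp_of_nonneg {t : ℝ} (h : 0 ≤ t) : ramp t = 1 :=
  min_eq_left (le_max_of_le_right (by linarith))

theorem ramp_of_le {t : ℝ} (h : t ≤ -1) : ramp t = 0 := by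
  rw [ramp, max_eq_left (by linarith), min_eq_right zero_le_one]

/-- The ramp already equals `1` at `0`, so the limit is the indicator of the closed half-line; this
is what produces `{p ≥ c}` rather than `{p > c}`. -/
theorem tendsto_ramp (t : ℝ) :
    Tendsto (fun n : ℕ => ramp (((n : ℝ) + 1) * t)) atTop
      (𝓝 ((Set.Ici 0).indicator (fun _ => 1) t)) := by
  rcases le_or_gt 0 t with h | h
  · rw [Set.indicator_of_mem (Set.mem_Ici.2 h)]
    exact tendsto_const_nhds.congr fun n => (ramp_of_nonneg (by positivity)).symm
  · rw [Set.indicator_of_notMem (by simpa using h)]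
    refine tendsto_const_nhds.congr' ?_
    have : Tendsto (fun n : ℕ => ((n : ℝ) + 1) * t) atTop atBot :=
      (tendsto_atTop_add_const_right _ _ tendsto_natCast_atTop_atTop).atTop_mul_const_of_neg h
    filter_upwards [this.eventually (eventually_le_atBot (-1))] with n hn
    exact (ramp_of_le hn).symm

/-- Rescaled to height `1 / k`, the ramp of slope `k` is `1`-Lipschitz. -/
theorem inv_mul_ramp_sub_le {k s t : ℝ} (hk : 0 < k) (h : s ≤ t) :
    k⁻¹ * ramp (k * t) - k⁻¹ * ramp (k * s) ≤ t - s := by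
  have h1 := ramp_le_add (k * s) (mul_nonneg hk.le (sub_nonneg.2 h))
  rw [show k * s + k * (t - s) = k * t by ring] at h1
  rw [← mul_sub, inv_mul_le_iff₀ hk]
  linarith

/-! ### Signed residual integrals over lower, upper and level sets -/

section Averages

variable [IsFiniteMeasure (volume.restrict X)]

theorem IsSigmaProjection.lower_setIntegral_nonneg (hX : MeasurableSet X)
    (hp : IsSigmaProjection σ X w f p) (hw : MemLp w ⊤ (volume.restrict X))
    (hf : MemLp f 2 (volume.restrict X)) (c : ℝ) {L : Set (Fin d → ℝ)}
    (hL : IsSigmaLower σ X L) (hLm : NullMeasurableSet L) :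
    0 ≤ ∫ x in L ∩ {x ∈ X | c ≤ p x}, (f x - p x) * w x := by
  have hLm' := hLm.mono (Measure.restrict_le_self (s := X))
  have hpm := hp.1.1.1.aemeasurable
  have hE : NullMeasurableSet (L ∩ {x ∈ X | c ≤ p x}) (volume.restrict X) :=
    hLm'.inter (hX.nullMeasurableSet.inter (nullMeasurableSet_le aemeasurable_const hpm))
  have := hp.mul_setIntegral_nonpos hw hf (fun x hx => hx.2.1) hE (-1)
    (h := fun n => L.indicator fun x => -ramp (((n : ℝ) + 1) * (p x - c))) ?_ ?_ ?_ ?_ hX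
  · linarith
  · intro n
    exact ((continuous_ramp.measurable.comp_aemeasurable
      ((hpm.sub_const c).const_mul _)).neg.indicator₀ hLm').aestronglyMeasurable
  · intro n x
    by_cases hx : x ∈ L <;> simp [hx, abs_ramp_le_one]
  · intro n
    obtain ⟨N, hN, hmono⟩ := hp.1.2
    refine ⟨N, hN, fun x hx y hy hxy => ?_⟩
    have hxy' := hmono x hx y hy hxy
    have hk : (0 : ℝ) < (n : ℝ) + 1 := by positivity
    have hlip := inv_mul_ramp_sub_le hk (sub_le_sub_right hxy' c)
    have h0 := mul_nonneg (inv_pos.2 hk).le (ramp_nonneg (((n : ℝ) + 1) * (p x - c)))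
    -- If `y ∈ L` then `x ∈ L`, and the Lipschitz bound compares the two decrements. If only `x ∈
    -- L`, only the smaller value is lowered.
    by_cases hyL : y ∈ L
    · have hxL := hL.2 x hx.1 y hy.1 hxy hyL
      simp only [Set.indicator_of_mem hxL, Set.indicator_of_mem hyL]
      linarith
    · by_cases hxL : x ∈ L
      · simp only [Set.indicator_of_mem hxL, Set.indicator_of_notMem hyL]
        linarith
      · simpa [hxL, hyL] using hxy'
  · intro x hxX
    by_cases hxL : x ∈ L
    · have := (tendsto_ramp (p x - c)).neg
      simp only [Set.indicator_of_mem hxL]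
      convert this using 2
      by_cases hc : c ≤ p x <;> simp [Set.indicator, hxL, hxX, hc]
    · simp [hxL]

theorem IsSigmaProjection.upper_setIntegral_nonpos (hX : MeasurableSet X)
    (hp : IsSigmaProjection σ X w f p) (hw : MemLp w ⊤ (volume.restrict X))
    (hf : MemLp f 2 (volume.restrict X)) (c : ℝ) {U : Set (Fin d → ℝ)}
    (hU : IsSigmaUpper σ X U) (hUm : NullMeasurableSet U) :
    ∫ x in {x ∈ X | p x ≤ c} ∩ U, (f x - p x) * w x ≤ 0 := by
  have hUm' := hUm.mono (Measure.restrict_le_self (s := X))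
  have hpm := hp.1.1.1.aemeasurable
  have hE : NullMeasurableSet ({x ∈ X | p x ≤ c} ∩ U) (volume.restrict X) :=
    (hX.nullMeasurableSet.inter (nullMeasurableSet_le hpm aemeasurable_const)).inter hUm'
  have := hp.mul_setIntegral_nonpos hw hf (fun x hx => hx.1.1) hE 1
    (h := fun n => U.indicator fun x => ramp (((n : ℝ) + 1) * (c - p x))) ?_ ?_ ?_ ?_ hX
  · linarith
  · intro n
    exact ((continuous_ramp.measurable.comp_aemeasurable
      ((hpm.const_sub c).const_mul _)).indicator₀ hUm').aestronglyMeasurable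
  · intro n x
    by_cases hx : x ∈ U <;> simp [hx, abs_ramp_le_one]
  · intro n
    obtain ⟨N, hN, hmono⟩ := hp.1.2
    refine ⟨N, hN, fun x hx y hy hxy => ?_⟩
    have hxy' := hmono x hx y hy hxy
    have hk : (0 : ℝ) < (n : ℝ) + 1 := by positivity
    have hlip := inv_mul_ramp_sub_le hk (sub_le_sub_left hxy' c)
    have h0 := mul_nonneg (inv_pos.2 hk).le (ramp_nonneg (((n : ℝ) + 1) * (c - p y)))
    by_cases hxU : x ∈ U
    · have hyU := hU.2 x hx.1 y hy.1 hxy hxU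
      simp only [Set.indicator_of_mem hxU, Set.indicator_of_mem hyU]
      linarith
    · by_cases hyU : y ∈ U
      · simp only [Set.indicator_of_notMem hxU, Set.indicator_of_mem hyU]
        linarith
      · simpa [hxU, hyU] using hxy'
  · intro x hxX
    by_cases hxU : x ∈ U
    · have := tendsto_ramp (c - p x)
      simp only [Set.indicator_of_mem hxU]
      convert this using 2
      by_cases hc : p x ≤ c <;> simp [Set.indicator, hxU, hxX, hc]
    · simp [hxU]

theorem IsSigmaProjection.level_setIntegral_eq_zero (hX : MeasurableSet X)
    (hp : IsSigmaProjection σ X w f p) (hw : MemLp w ⊤ (volume.restrict X))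
    (hf : MemLp f 2 (volume.restrict X)) (c : ℝ) :
    ∫ x in {x ∈ X | p x = c}, (f x - p x) * w x = 0 := by
  have hpm := hp.1.1.1.aemeasurable
  have hE : NullMeasurableSet {x ∈ X | p x = c} (volume.restrict X) :=
    hX.nullMeasurableSet.inter (nullMeasurableSet_eq_fun hpm aemeasurable_const)
  -- The tent around `c` is two-sided `1`-Lipschitz in `p`, so both signs are feasible and the
  -- integral is squeezed to `0`.
  have key : ∀ s : ℝ, |s| = 1 → s * ∫ x in {x ∈ X | p x = c}, (f x - p x) * w x ≤ 0 := by
    intro s hs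
    refine hp.mul_setIntegral_nonpos hw hf (fun x hx => hx.1) hE s
      (h := fun n x => s * ramp (((n : ℝ) + 1) * -|p x - c|)) ?_ ?_ ?_ ?_ hX
    · intro n
      exact ((continuous_ramp.comp (by fun_prop :
        Continuous fun t : ℝ => ((n : ℝ) + 1) * -|t - c|)).comp_aestronglyMeasurable
          hp.1.1.1).const_mul s
    · intro n x
      rw [abs_mul, hs, one_mul]
      exact abs_ramp_le_one _
    · intro n
      obtain ⟨N, hN, hmono⟩ := hp.1.2
      refine ⟨N, hN, fun x hx y hy hxy => ?_⟩
      have hxy' := hmono x hx y hy hxy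
      have hk : (0 : ℝ) < (n : ℝ) + 1 := by positivity
      have hlip : |((n : ℝ) + 1)⁻¹ * ramp (((n : ℝ) + 1) * -|p x - c|) -
          ((n : ℝ) + 1)⁻¹ * ramp (((n : ℝ) + 1) * -|p y - c|)| ≤ p y - p x := by
        have hab : |(|p x - c| - |p y - c|)| ≤ p y - p x := by
          refine (abs_abs_sub_abs_le_abs_sub _ _).trans ?_
          rw [sub_sub_sub_cancel_right, abs_sub_comm, abs_of_nonneg (sub_nonneg.2 hxy')]
        have hmon := fun s t : ℝ => fun hst : s ≤ t => mul_le_mul_of_nonneg_left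
          (ramp_mono (mul_le_mul_of_nonneg_left hst hk.le)) (inv_pos.2 hk).le
        rw [abs_le] at hab
        rcases le_total (-|p x - c|) (-|p y - c|) with h | h
        · have h1 := inv_mul_ramp_sub_le hk h
          have h2 := hmon _ _ h
          rw [abs_le]; constructor <;> linarith
        · have h1 := inv_mul_ramp_sub_le hk h
          have h2 := hmon _ _ h
          rw [abs_le]; constructor <;> linarith
      rw [abs_le] at hlip
      rcases (abs_eq zero_le_one).1 hs with rfl | rfl <;> dsimp only <;> linarith
    · intro x hxX
      have := (tendsto_ramp (-|p x - c|)).const_mul s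
      convert this using 2
      by_cases hc : p x = c
      · simp [Set.indicator, hxX, hc]
      · simp [Set.indicator, hc, sub_eq_zero]
  have h1 := key 1 (by simp)
  have h2 := key (-1) (by simp)
  linarith

end Averages

/-! ### Positivity and integrability with the weight -/

section Weights

variable {E : Set (Fin d → ℝ)} {m : ℝ}

theorem setIntegral_weight_pos [IsFiniteMeasure (volume.restrict X)] (hEX : E ⊆ X)
    (hw : MemLp w ⊤ (volume.restrict X)) (hm : 0 < m)
    (hmw : ∀ᵐ x ∂volume.restrict X, m ≤ w x) (hE : 0 < volume E) : 0 < ∫ x in E, w x := by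
  have hle : volume.restrict E ≤ volume.restrict X := Measure.restrict_mono hEX le_rfl
  have : IsFiniteMeasure (volume.restrict E) := isFiniteMeasure_of_le _ hle
  have hint : Integrable w (volume.restrict E) := (hw.integrable le_top).mono_measure hle
  have h1 : ∫ _ in E, m ≤ ∫ x in E, w x :=
    integral_mono_ae (integrable_const m) hint (ae_mono hle hmw)
  refine lt_of_lt_of_le ?_ h1
  rw [integral_const, smul_eq_mul]
  refine mul_pos ?_ hm
  rw [measureReal_restrict_apply_univ, measureReal_def]
  refine ENNReal.toReal_pos hE.ne' ?_
  simpa using measure_ne_top (volume.restrict E) Set.univ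

theorem integrable_mul_weight [IsFiniteMeasure (volume.restrict X)] (hEX : E ⊆ X)
    (hw : MemLp w ⊤ (volume.restrict X)) (hg : MemLp g 2 (volume.restrict X)) :
    Integrable (fun x => g x * w x) (volume.restrict E) :=
  ((memLp_two_mul_of_top hg hw).integrable one_le_two |>.congr
    (ae_of_all _ fun _ => mul_comm _ _)).mono_measure (Measure.restrict_mono hEX le_rfl)

theorem measure_eq_zero_of_setIntegral_nonneg (hint : Integrable g (volume.restrict E))
    (h0 : 0 ≤ ∫ x in E, g x) (hneg : ∀ᵐ x ∂volume.restrict E, g x < 0) : volume E = 0 := by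
  have hle : 0 ≤ᵐ[volume.restrict E] fun x => -g x :=
    hneg.mono fun x hx => neg_nonneg.2 hx.le
  have hz : ∫ x in E, -g x = 0 :=
    le_antisymm (by rw [integral_neg]; linarith) (integral_nonneg_of_ae hle)
  have hz' := (integral_eq_zero_iff_of_nonneg_ae hle hint.neg).1 hz
  have hfalse : ∀ᵐ x ∂volume.restrict E, False := by
    filter_upwards [hz', hneg] with x h1 h2
    exact h2.ne (neg_eq_zero.1 h1)
  rwa [eventually_false_iff_eq_bot, ae_eq_bot, Measure.restrict_eq_zero] at hfalse

end Weights

/-! ### Averages and range of the projection -/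

section Main

variable [IsFiniteMeasure (volume.restrict X)] {m : ℝ}

theorem IsSigmaProjection.le_Av (hX : MeasurableSet X)
    (hp : IsSigmaProjection σ X w f p) (hw : MemLp w ⊤ (volume.restrict X)) (hm : 0 < m)
    (hmw : ∀ᵐ x ∂volume.restrict X, m ≤ w x)
    (hf : MemLp f 2 (volume.restrict X)) (c : ℝ) {L : Set (Fin d → ℝ)}
    (hL : IsSigmaLower σ X L) (hLm : NullMeasurableSet L)
    (hpos : 0 < volume (L ∩ {x ∈ X | c ≤ p x})) : c ≤ Av f w (L ∩ {x ∈ X | c ≤ p x}) := by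
  have hEX : L ∩ {x ∈ X | c ≤ p x} ⊆ X := fun x hx => hx.2.1
  have h0 := hp.lower_setIntegral_nonneg hX hw hf c hL hLm
  have hpm := hp.1.1.1.aemeasurable
  have hE : NullMeasurableSet (L ∩ {x ∈ X | c ≤ p x}) (volume.restrict X) :=
    (hLm.mono (Measure.restrict_le_self (s := X))).inter
      (hX.nullMeasurableSet.inter (nullMeasurableSet_le aemeasurable_const hpm))
  rw [Av, le_div_iff₀ (setIntegral_weight_pos hEX hw hm hmw hpos), ← integral_const_mul]
  have hif := integrable_mul_weight hEX hw hf
  have hip := integrable_mul_weight hEX hw hp.1.1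
  simp only [sub_mul] at h0
  rw [integral_sub hif hip, sub_nonneg] at h0
  refine le_trans (integral_mono_ae (integrable_mul_weight hEX hw (memLp_const c)) hip ?_) h0
  rw [← Measure.restrict_restrict_of_subset hEX]
  filter_upwards [ae_restrict_mem₀ hE, ae_restrict_of_ae hmw] with x hx hxw
  exact mul_le_mul_of_nonneg_right hx.2.2 (hm.le.trans hxw)

theorem IsSigmaProjection.Av_le (hX : MeasurableSet X)
    (hp : IsSigmaProjection σ X w f p) (hw : MemLp w ⊤ (volume.restrict X)) (hm : 0 < m)
    (hmw : ∀ᵐ x ∂volume.restrict X, m ≤ w x)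
    (hf : MemLp f 2 (volume.restrict X)) (c : ℝ) {U : Set (Fin d → ℝ)}
    (hU : IsSigmaUpper σ X U) (hUm : NullMeasurableSet U)
    (hpos : 0 < volume ({x ∈ X | p x ≤ c} ∩ U)) : Av f w ({x ∈ X | p x ≤ c} ∩ U) ≤ c := by
  have hEX : {x ∈ X | p x ≤ c} ∩ U ⊆ X := fun x hx => hx.1.1
  have h0 := hp.upper_setIntegral_nonpos hX hw hf c hU hUm
  have hpm := hp.1.1.1.aemeasurable
  have hE : NullMeasurableSet ({x ∈ X | p x ≤ c} ∩ U) (volume.restrict X) :=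
    (hX.nullMeasurableSet.inter (nullMeasurableSet_le hpm aemeasurable_const)).inter
      (hUm.mono (Measure.restrict_le_self (s := X)))
  rw [Av, div_le_iff₀ (setIntegral_weight_pos hEX hw hm hmw hpos), ← integral_const_mul]
  have hif := integrable_mul_weight hEX hw hf
  have hip := integrable_mul_weight hEX hw hp.1.1
  simp only [sub_mul] at h0
  rw [integral_sub hif hip, sub_nonpos] at h0
  refine h0.trans (integral_mono_ae hip (integrable_mul_weight hEX hw (memLp_const c)) ?_)
  rw [← Measure.restrict_restrict_of_subset hEX]
  filter_upwards [ae_restrict_mem₀ hE, ae_restrict_of_ae hmw] with x hx hxw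
  exact mul_le_mul_of_nonneg_right hx.1.2 (hm.le.trans hxw)

theorem IsSigmaProjection.Av_eq (hX : MeasurableSet X)
    (hp : IsSigmaProjection σ X w f p) (hw : MemLp w ⊤ (volume.restrict X)) (hm : 0 < m)
    (hmw : ∀ᵐ x ∂volume.restrict X, m ≤ w x)
    (hf : MemLp f 2 (volume.restrict X)) (c : ℝ)
    (hpos : 0 < volume {x ∈ X | p x = c}) : Av f w {x ∈ X | p x = c} = c := by
  have hEX : {x ∈ X | p x = c} ⊆ X := fun x hx => hx.1
  have h0 := hp.level_setIntegral_eq_zero hX hw hf c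
  have hpm := hp.1.1.1.aemeasurable
  have hE : NullMeasurableSet {x ∈ X | p x = c} (volume.restrict X) :=
    hX.nullMeasurableSet.inter (nullMeasurableSet_eq_fun hpm aemeasurable_const)
  rw [Av, div_eq_iff (setIntegral_weight_pos hEX hw hm hmw hpos).ne', ← integral_const_mul]
  simp only [sub_mul] at h0
  rw [integral_sub (integrable_mul_weight hEX hw hf) (integrable_mul_weight hEX hw hp.1.1),
    sub_eq_zero] at h0
  rw [h0]
  refine integral_congr_ae ?_
  rw [← Measure.restrict_restrict_of_subset hEX]
  filter_upwards [ae_restrict_mem₀ hE] with x hx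
  rw [hx.2]

theorem IsSigmaProjection.ae_lt_of_ae_lt (hX : MeasurableSet X)
    (hp : IsSigmaProjection σ X w f p) (hw : MemLp w ⊤ (volume.restrict X)) (hm : 0 < m)
    (hmw : ∀ᵐ x ∂volume.restrict X, m ≤ w x)
    (hf : MemLp f 2 (volume.restrict X)) {c : ℝ} (hfc : ∀ᵐ x ∂volume.restrict X, f x < c) :
    ∀ᵐ x ∂volume.restrict X, p x < c := by
  have hEX : {x ∈ X | c ≤ p x} ⊆ X := fun x hx => hx.1
  have hE : NullMeasurableSet {x ∈ X | c ≤ p x} (volume.restrict X) :=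
    hX.nullMeasurableSet.inter (nullMeasurableSet_le aemeasurable_const hp.1.1.1.aemeasurable)
  -- The whole of `X` is trivially a lower set of itself.
  have h0 := hp.lower_setIntegral_nonneg hX hw hf c
    (L := X) ⟨le_rfl, fun x hx _ _ _ _ => hx⟩ hX.nullMeasurableSet
  rw [Set.inter_eq_self_of_subset_right hEX] at h0
  have h := measure_eq_zero_of_setIntegral_nonneg
    (integrable_mul_weight hEX hw (hf.sub hp.1.1)) h0 ?_
  · rw [ae_restrict_iff' hX, ae_iff]
    simpa using h
  · rw [← Measure.restrict_restrict_of_subset hEX]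
    filter_upwards [ae_restrict_mem₀ hE, ae_restrict_of_ae hmw, ae_restrict_of_ae hfc]
      with x hx hxw hxf
    exact mul_neg_of_neg_of_pos (sub_neg.2 (hxf.trans_le hx.2)) (hm.trans_le hxw)

theorem IsSigmaProjection.ae_gt_of_ae_gt (hX : MeasurableSet X)
    (hp : IsSigmaProjection σ X w f p) (hw : MemLp w ⊤ (volume.restrict X)) (hm : 0 < m)
    (hmw : ∀ᵐ x ∂volume.restrict X, m ≤ w x)
    (hf : MemLp f 2 (volume.restrict X)) {c : ℝ} (hfc : ∀ᵐ x ∂volume.restrict X, c < f x) :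
    ∀ᵐ x ∂volume.restrict X, c < p x := by
  have hEX : {x ∈ X | p x ≤ c} ⊆ X := fun x hx => hx.1
  have hE : NullMeasurableSet {x ∈ X | p x ≤ c} (volume.restrict X) :=
    hX.nullMeasurableSet.inter (nullMeasurableSet_le hp.1.1.1.aemeasurable aemeasurable_const)
  have h0 := hp.upper_setIntegral_nonpos hX hw hf c
    (U := X) ⟨le_rfl, fun _ _ y hy _ _ => hy⟩ hX.nullMeasurableSet
  rw [Set.inter_eq_self_of_subset_left hEX, ← neg_nonneg, ← integral_neg] at h0
  have h := measure_eq_zero_of_setIntegral_nonneg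
    (integrable_mul_weight hEX hw (hf.sub hp.1.1)).neg h0 ?_
  · rw [ae_restrict_iff' hX, ae_iff]
    simpa using h
  · rw [← Measure.restrict_restrict_of_subset hEX]
    filter_upwards [ae_restrict_mem₀ hE, ae_restrict_of_ae hmw, ae_restrict_of_ae hfc]
      with x hx hxw hxf
    exact neg_neg_of_pos (mul_pos (sub_pos.2 (hx.2.trans_lt hxf)) (hm.trans_le hxw))

/-- The strict version applies to each `c + 1/(n+1)`, and countably many null sets are discarded. -/
theorem IsSigmaProjection.ae_le_of_ae_le (hX : MeasurableSet X)
    (hp : IsSigmaProjection σ X w f p) (hw : MemLp w ⊤ (volume.restrict X)) (hm : 0 < m)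
    (hmw : ∀ᵐ x ∂volume.restrict X, m ≤ w x)
    (hf : MemLp f 2 (volume.restrict X)) {c : ℝ} (hfc : ∀ᵐ x ∂volume.restrict X, f x ≤ c) :
    ∀ᵐ x ∂volume.restrict X, p x ≤ c := by
  have h : ∀ n : ℕ, ∀ᵐ x ∂volume.restrict X, p x < c + 1 / ((n : ℝ) + 1) := fun n =>
    hp.ae_lt_of_ae_lt hX hw hm hmw hf (hfc.mono fun x hx => by
      have : (0 : ℝ) < 1 / ((n : ℝ) + 1) := by positivity
      linarith)
  filter_upwards [ae_all_iff.2 h] with x hx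
  refine le_of_forall_pos_le_add fun ε hε => ?_
  obtain ⟨n, hn⟩ := exists_nat_one_div_lt hε
  linarith [hx n]

theorem IsSigmaProjection.ae_ge_of_ae_ge (hX : MeasurableSet X)
    (hp : IsSigmaProjection σ X w f p) (hw : MemLp w ⊤ (volume.restrict X)) (hm : 0 < m)
    (hmw : ∀ᵐ x ∂volume.restrict X, m ≤ w x)
    (hf : MemLp f 2 (volume.restrict X)) {c : ℝ} (hfc : ∀ᵐ x ∂volume.restrict X, c ≤ f x) :
    ∀ᵐ x ∂volume.restrict X, c ≤ p x := by
  have h : ∀ n : ℕ, ∀ᵐ x ∂volume.restrict X, c - 1 / ((n : ℝ) + 1) < p x := fun n =>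
    hp.ae_gt_of_ae_gt hX hw hm hmw hf (hfc.mono fun x hx => by
      have : (0 : ℝ) < 1 / ((n : ℝ) + 1) := by positivity
      linarith)
  filter_upwards [ae_all_iff.2 h] with x hx
  refine le_of_forall_pos_le_add fun ε hε => ?_
  obtain ⟨n, hn⟩ := exists_nat_one_div_lt hε
  linarith [hx n]

/-- It suffices to trap `p x` between two members of `I`. At each end, an attained bound calls for
the weak comparison, an unattained one for the strict comparison, and an unbounded end for nothing.
-/
theorem IsSigmaProjection.ae_mem_of_ae_mem (hX : MeasurableSet X)
    (hp : IsSigmaProjection σ X w f p) (hw : MemLp w ⊤ (volume.restrict X)) (hm : 0 < m)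
    (hmw : ∀ᵐ x ∂volume.restrict X, m ≤ w x)
    (hf : MemLp f 2 (volume.restrict X)) {I : Set ℝ} (hI : I.OrdConnected)
    (hfI : ∀ᵐ x ∂volume.restrict X, f x ∈ I) : ∀ᵐ x ∂volume.restrict X, p x ∈ I := by
  rcases I.eq_empty_or_nonempty with rfl | hne
  · exact hfI.mono fun x hx => hx.elim
  have hup : ∀ᵐ x ∂volume.restrict X, ∃ i ∈ I, p x ≤ i := by
    by_cases hb : BddAbove I
    · by_cases hc : sSup I ∈ I
      · exact (hp.ae_le_of_ae_le hX hw hm hmw hf (hfI.mono fun x hx => le_csSup hb hx)).mono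
          fun x hx => ⟨_, hc, hx⟩
      · refine (hp.ae_lt_of_ae_lt hX hw hm hmw hf (hfI.mono fun x hx =>
          (le_csSup hb hx).lt_of_ne fun h => hc (h ▸ hx))).mono fun x hx => ?_
        obtain ⟨i, hi, hxi⟩ := exists_lt_of_lt_csSup hne hx
        exact ⟨i, hi, hxi.le⟩
    · refine ae_of_all _ fun x => ?_
      obtain ⟨i, hi, hxi⟩ := not_bddAbove_iff.1 hb (p x)
      exact ⟨i, hi, hxi.le⟩
  have hlow : ∀ᵐ x ∂volume.restrict X, ∃ i ∈ I, i ≤ p x := by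
    by_cases hb : BddBelow I
    · by_cases hc : sInf I ∈ I
      · exact (hp.ae_ge_of_ae_ge hX hw hm hmw hf (hfI.mono fun x hx => csInf_le hb hx)).mono
          fun x hx => ⟨_, hc, hx⟩
      · refine (hp.ae_gt_of_ae_gt hX hw hm hmw hf (hfI.mono fun x hx =>
          (csInf_le hb hx).lt_of_ne fun h => hc (h ▸ hx))).mono fun x hx => ?_
        obtain ⟨i, hi, hxi⟩ := exists_lt_of_csInf_lt hne hx
        exact ⟨i, hi, hxi.le⟩
    · refine ae_of_all _ fun x => ?_
      obtain ⟨i, hi, hxi⟩ := not_bddBelow_iff.1 hb (p x)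
      exact ⟨i, hi, hxi.le⟩
  filter_upwards [hup, hlow] with x ⟨i, hi, hxi⟩ ⟨j, hj, hjx⟩
  exact hI.out hj hi ⟨hjx, hxi⟩

end Main

end MonReg

theorem corollary5p2 {d : ℕ} (σ : Fin d → SignType) (a b : Fin d → ℝ) (hab : ∀ i, a i < b i)
    (w : (Fin d → ℝ) → ℝ) (hw : MonReg.MemSInftyPos a b w)
    (f : (Fin d → ℝ) → ℝ) (hf : MemLp f 2 (volume.restrict (Set.Icc a b)))
    (fs : (Fin d → ℝ) → ℝ)
    (hfs : fs =ᵐ[volume.restrict (Set.Icc a b)] MonReg.monRegression σ (Set.Icc a b) w f) :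
    (∀ (c : ℝ) (L : Set (Fin d → ℝ)), MonReg.IsSigmaLower σ (Set.Icc a b) L →
      NullMeasurableSet L volume → 0 < volume (L ∩ {x ∈ Set.Icc a b | c ≤ fs x}) →
      c ≤ MonReg.Av f w (L ∩ {x ∈ Set.Icc a b | c ≤ fs x})) ∧
    (∀ (c : ℝ) (U : Set (Fin d → ℝ)), MonReg.IsSigmaUpper σ (Set.Icc a b) U →
      NullMeasurableSet U volume → 0 < volume ({x ∈ Set.Icc a b | fs x ≤ c} ∩ U) →
      MonReg.Av f w ({x ∈ Set.Icc a b | fs x ≤ c} ∩ U) ≤ c) ∧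
    (∀ c : ℝ, 0 < volume {x ∈ Set.Icc a b | fs x = c} →
      MonReg.Av f w {x ∈ Set.Icc a b | fs x = c} = c) ∧
    (∀ I : Set ℝ, I.OrdConnected → (∀ᵐ x ∂volume.restrict (Set.Icc a b), f x ∈ I) →
      ∀ᵐ x ∂volume.restrict (Set.Icc a b), fs x ∈ I) := by
  obtain ⟨m, hm, hmw⟩ := hw.exists_ae_ge
  have hX : MeasurableSet (Set.Icc a b) := measurableSet_Icc
  have : IsFiniteMeasure (volume.restrict (Set.Icc a b)) :=
    isFiniteMeasure_restrict.2 isCompact_Icc.measure_lt_top.ne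
  -- Existence makes the chosen representative a minimizer, and changing it on a null set preserves
  -- this; uniqueness is not needed.
  have hp : MonReg.IsSigmaProjection σ (Set.Icc a b) w f fs :=
    (Classical.epsilon_spec (MonReg.exists_isSigmaProjection hX hw.1 hm hmw hf)).congr_ae hX hfs
  exact ⟨fun c L hL hLm hpos => hp.le_Av hX hw.1 hm hmw hf c hL hLm hpos,
    fun c U hU hUm hpos => hp.Av_le hX hw.1 hm hmw hf c hU hUm hpos,
    fun c hpos => hp.Av_eq hX hw.1 hm hmw hf c hpos,
    fun I hI hfI => hp.ae_mem_of_ae_mem hX hw.1 hm hmw hf hI hfI⟩
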